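/- Let $(H,R)$ be a triangular Hopf algebra over $\mathbf{C}$, not necessarily finite-dimensional: $H$ is a Hopf algebra with comultiplication $\Delta$ and antipode $S$, and $R\in H\otimes H$ is an invertible element such that $(\Delta\otimes\mathrm{id})(R)=R_{13}R_{23}$, $(\mathrm{id}\otimes\Delta)(R)=R_{13}R_{12}$, $R\,\Delta(h)=\Delta^{\mathrm{op}}(h)\,R$ for all $h\in H$, and $R_{21}=R^{-1}$. For a finite-dimensional representation $V$ of $H$, let $V^*$ be the dual representation, $(hf)(v)=f(S(h)v)$, and let the categorical dimension $\dim_c(V)\in\mathbf{C}$ be the scalar given by the composite $$\mathbf{C}\longrightarrow V\otimes V^*\xrightarrow{\ \beta_{V,V^*}\ }V^*\otimes V\longrightarrow\mathbf{C},$$ where the first map is $1\mapsto\sum_i v_i\otimes v_i^*$ for a basis $(v_i)$ of $V$ with dual basis $(v_i^*)$, $\beta_{V,V^*}$ is the action of $R$ followed by the flip of the two factors, and the last map is $f\otimes v\mapsto f(v)$. Let $u=\sum_j S(b_j)a_j$, where $R=\sum_j a_j\otimes b_j$, be the Drinfeld element of $(H,R)$. Then for every finite-dimensional representation $V$ of $H$,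 the categorical dimension $\dim_c(V)=\mathrm{tr}(u|_V)$ is an integer. -/

import Mathlib

open scoped TensorProduct

namespace TriangularHopf

section HopfSide

variable {k H : Type*} [CommRing k] [Ring H] [HopfAlgebra k H]

/-- The image of `R` under `a ⊗ b ↦ a ⊗ b ⊗ 1`. -/
noncomputable def leg12 (R : H ⊗[k] H) : H ⊗[k] (H ⊗[k] H) :=
  Algebra.TensorProduct.map (AlgHom.id k H)
    (Algebra.TensorProduct.includeLeft : H →ₐ[k] H ⊗[k] H) R

/-- The image of `R` under `a ⊗ b ↦ a ⊗ 1 ⊗ b`. -/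
noncomputable def leg13 (R : H ⊗[k] H) : H ⊗[k] (H ⊗[k] H) :=
  Algebra.TensorProduct.map (AlgHom.id k H)
    (Algebra.TensorProduct.includeRight : H →ₐ[k] H ⊗[k] H) R

/-- The image of `R` under `a ⊗ b ↦ 1 ⊗ a ⊗ b`. -/
noncomputable def leg23 (R : H ⊗[k] H) : H ⊗[k] (H ⊗[k] H) :=
  (1 : H) ⊗ₜ[k] R

/-- `R` is a quasitriangular structure (a universal R-matrix) on the Hopf algebra `H`. -/
structure IsQuasitriangular (R : H ⊗[k] H) : Prop where
  isUnit : IsUnit R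
  /-- `(Δ ⊗ id)(R) = R₁₃ R₂₃` -/
  comul_left : TensorProduct.assoc k H H H
    ((Coalgebra.comul (R := k) (A := H)).rTensor H R) = leg13 R * leg23 R
  /-- `(id ⊗ Δ)(R) = R₁₃ R₁₂` -/
  comul_right : (Coalgebra.comul (R := k) (A := H)).lTensor H R = leg13 R * leg12 R
  /-- `R Δ(h) = Δᵒᵖ(h) R` -/
  intertwines : ∀ h : H, R * Coalgebra.comul (R := k) h =
    TensorProduct.comm k H H (Coalgebra.comul (R := k) h) * R

/-- `R` is a triangular structure on the Hopf algebra `H`: it is quasitriangular and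
`R₂₁ = R⁻¹`. Since `R` is a unit, the one-sided identity `R₂₁ R = 1` says exactly this. -/
structure IsTriangular (R : H ⊗[k] H) : Prop extends IsQuasitriangular R where
  flip_mul_self : TensorProduct.comm k H H R * R = 1

/-- The Drinfeld element `u = m ∘ τ ∘ (id ⊗ S) (R)`, that is `u = ∑ S(bᵢ) aᵢ` for
`R = ∑ aᵢ ⊗ bᵢ`. -/
noncomputable def drinfeldElement (R : H ⊗[k] H) : H :=
  LinearMap.mul' k H (TensorProduct.comm k H H
    ((HopfAlgebra.antipode k (A := H)).lTensor H R))

end HopfSide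

section Representations

variable {k H V W : Type*} [Field k] [Ring H] [HopfAlgebra k H]
  [AddCommGroup V] [Module k V] [AddCommGroup W] [Module k W]

/-- The dual representation: `(a • f) v = f (S(a) • v)`. -/
noncomputable def dualRep (ρ : H →ₐ[k] Module.End k V) :
    H →ₐ[k] Module.End k (Module.Dual k V) :=
  AlgHom.ofLinearMap
    (Module.Dual.transpose (R := k) ∘ₗ ρ.toLinearMap ∘ₗ HopfAlgebra.antipode k)
    (by ext f v; simp [Module.Dual.transpose])
    (by intro a b; ext f v; simp [Module.Dual.transpose, HopfAlgebra.antipode_mul_antidistrib])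

/-- The action of `H ⊗ H` on `V ⊗ W`: `(a ⊗ b) • (v ⊗ w) = (a • v) ⊗ (b • w)`. -/
noncomputable def tensorAction (ρ : H →ₐ[k] Module.End k V) (σ : H →ₐ[k] Module.End k W) :
    H ⊗[k] H →ₗ[k] Module.End k (V ⊗[k] W) :=
  TensorProduct.homTensorHomMap (RingHom.id k) V W V W ∘ₗ
    TensorProduct.map ρ.toLinearMap σ.toLinearMap

/-- The commutativity constraint `V ⊗ W → W ⊗ V` of the category of representations of `(H, R)`:
act by `R`, then flip the two factors. -/
noncomputable def braiding (R : H ⊗[k] H)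
    (ρ : H →ₐ[k] Module.End k V) (σ : H →ₐ[k] Module.End k W) :
    V ⊗[k] W →ₗ[k] W ⊗[k] V :=
  (TensorProduct.comm k V W).toLinearMap ∘ₗ tensorAction ρ σ R

/-- The categorical dimension of a finite-dimensional representation `V` of `(H, R)`: the scalar
by which the composite `k → V ⊗ V* → V* ⊗ V → k` acts, where the first arrow is
`1 ↦ ∑ vᵢ ⊗ vᵢ*`, the second one is the commutativity constraint, and the third one is
`f ⊗ v ↦ f v`. -/
noncomputable def categoricalDim [FiniteDimensional k V] (R : H ⊗[k] H)
    (ρ : H →ₐ[k] Module.End k V) : k :=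
  (contractLeft k V ∘ₗ braiding R ρ (dualRep ρ) ∘ₗ coevaluation k V) 1

end Representations

end TriangularHopf

/-! The identity `R₂₁ R = 1` and the Yang–Baxter equation make the braidings of neighbouring factors
generate an action of the symmetric group on the tensor powers of `V`. Put `d = tr(u|_V)` and `N =
dim V`. The partial trace over the last factor, weighted by `u`, multiplies by `d` an operator not
involving that factor. It sends the last braiding to the identity, because `∑ b u a = 1`
(`IsQuasitriangular.sandwich_drinfeldElement`). On permutations it therefore acts by deleting the
last point from its cycle, with a factor `d` for a fixed point.

Suppose `d` is not an integer. Then the group algebra of each symmetric group acts faithfully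
(`IsMarkovSystem.snd_eq_zero`). Indeed, let `x` act by zero, and let `n` be the last point. The
deletions of all `x (j n)` act by zero, hence vanish by induction. Multiplied back by `(j n)` and
summed, they give `(d + J) x`, where `J` is the Jucys–Murphy element (`sum_deletePoint_mul_swap`).
So `J x = -d x`, while `J` has only integer eigenvalues (`eq_zero_of_jucysMurphy_mul_eq_smul`);
hence `x = 0`. Faithfulness on `n` strands forces `n! ≤ N^(2n)` for all `n`, which is absurd. -/

namespace TriangularHopf

/-! ### Identities for the universal R-matrix and the Drinfeld element -/

section HopfIdentities

variable {k H : Type*} [CommRing k] [Ring H] [HopfAlgebra k H]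

open Coalgebra HopfAlgebra

/-- The linear map `a ⊗ b ↦ ε(b) a`. -/
noncomputable def counitRight (k H : Type*) [CommRing k] [Ring H] [HopfAlgebra k H] :
    H ⊗[k] H →ₗ[k] H :=
  (TensorProduct.rid k H).toLinearMap ∘ₗ (counit (R := k) (A := H)).lTensor H

@[simp]
theorem counitRight_tmul (a b : H) :
    counitRight k H (a ⊗ₜ[k] b) = counit (R := k) b • a := by
  simp [counitRight]

@[simp]
theorem leg12_tmul (a b : H) : leg12 (a ⊗ₜ[k] b) = a ⊗ₜ[k] (b ⊗ₜ[k] 1) := by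
  simp [leg12]

@[simp]
theorem leg13_tmul (a b : H) : leg13 (a ⊗ₜ[k] b) = a ⊗ₜ[k] (1 ⊗ₜ[k] b) := by
  simp [leg13]

theorem leg12_add (R T : H ⊗[k] H) : leg12 (R + T) = leg12 R + leg12 T := by
  simp [leg12]

theorem leg13_add (R T : H ⊗[k] H) : leg13 (R + T) = leg13 R + leg13 T := by
  simp [leg13]

theorem leg23_add (R T : H ⊗[k] H) : leg23 (R + T) = leg23 R + leg23 T := by
  simp [leg23, TensorProduct.tmul_add]

@[simp]
theorem leg12_zero : leg12 (0 : H ⊗[k] H) = 0 := by simp [leg12]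

@[simp]
theorem leg13_zero : leg13 (0 : H ⊗[k] H) = 0 := by simp [leg13]

@[simp]
theorem leg23_zero : leg23 (0 : H ⊗[k] H) = 0 := by simp [leg23]

/-- The linear map `a ⊗ b ⊗ c ↦ ε(b) a ⊗ c`. -/
noncomputable def counitMiddle (k H : Type*) [CommRing k] [Ring H] [HopfAlgebra k H] :
    H ⊗[k] (H ⊗[k] H) →ₗ[k] H ⊗[k] H :=
  ((TensorProduct.lid k H).toLinearMap ∘ₗ (counit (R := k) (A := H)).rTensor H).lTensor H

theorem counitMiddle_lTensor_comul (T : H ⊗[k] H) :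
    counitMiddle k H ((comul (R := k) (A := H)).lTensor H T) = T := by
  induction T with
  | zero => simp
  | add x y hx hy => simp [hx, hy]
  | tmul a b => simp [counitMiddle]

theorem counitMiddle_leg_mul (R T : H ⊗[k] H) :
    counitMiddle k H (leg13 R * leg12 T) = R * (counitRight k H T ⊗ₜ[k] 1) := by
  induction R with
  | zero => simp
  | add x y hx hy => simp [leg13_add, add_mul, hx, hy]
  | tmul a b =>
    induction T with
    | zero => simp
    | add x y hx hy => rw [leg12_add, mul_add, map_add, hx, hy, map_add, TensorProduct.add_tmul, mul_add]
    | tmul c d =>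
      simp [counitMiddle, TensorProduct.smul_tmul']

/-- Applying the counit to the middle leg of `(id ⊗ Δ)(R) = R₁₃ R₁₂` gives `R = R · ((id ⊗ ε)(R) ⊗
1)`, and `R` can be cancelled. -/
theorem IsQuasitriangular.counitRight_eq_one {R : H ⊗[k] H} (hR : IsQuasitriangular R) :
    counitRight k H R = 1 := by
  have h := congrArg (counitMiddle k H) hR.comul_right
  rw [counitMiddle_lTensor_comul, counitMiddle_leg_mul] at h
  have h1 : counitRight k H R ⊗ₜ[k] (1 : H) = 1 :=
    hR.isUnit.mul_left_cancel (by rw [← h, mul_one])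
  simpa [Algebra.TensorProduct.one_def] using congrArg (counitRight k H) h1

/-- The linear map `a ⊗ b ⊗ c ↦ b S(c) a`. -/
noncomputable def antipodeContraction (k H : Type*) [CommRing k] [Ring H] [HopfAlgebra k H] :
    H ⊗[k] (H ⊗[k] H) →ₗ[k] H :=
  LinearMap.mul' k H ∘ₗ (TensorProduct.comm k H H).toLinearMap ∘ₗ
    (LinearMap.mul' k H ∘ₗ (antipode k (A := H)).lTensor H).lTensor H

/-- The linear map `a ⊗ b ↦ b c a`. -/
noncomputable def sandwich (k : Type*) {H : Type*} [CommRing k] [Ring H] [HopfAlgebra k H]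
    (c : H) : H ⊗[k] H →ₗ[k] H :=
  LinearMap.mul' k H ∘ₗ (LinearMap.mulRight k c).rTensor H ∘ₗ
    (TensorProduct.comm k H H).toLinearMap

@[simp]
theorem sandwich_tmul (c a b : H) : sandwich k c (a ⊗ₜ[k] b) = b * c * a := by
  simp [sandwich]

theorem sandwich_add (c d : H) (T : H ⊗[k] H) :
    sandwich k (c + d) T = sandwich k c T + sandwich k d T := by
  induction T with
  | zero => simp
  | add x y hx hy => simp only [map_add, hx, hy]; abel
  | tmul a b => simp [mul_add, add_mul]

theorem antipodeContraction_lTensor_comul (T : H ⊗[k] H) :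
    antipodeContraction k H ((comul (R := k) (A := H)).lTensor H T) = counitRight k H T := by
  induction T with
  | zero => simp
  | add x y hx hy => simp [hx, hy]
  | tmul a b => simp [antipodeContraction, Algebra.smul_def]

theorem drinfeldElement_add (R T : H ⊗[k] H) :
    drinfeldElement (R + T) = drinfeldElement R + drinfeldElement T := by
  simp [drinfeldElement]

theorem antipodeContraction_leg_mul (R T : H ⊗[k] H) :
    antipodeContraction k H (leg13 R * leg12 T) = sandwich k (drinfeldElement R) T := by
  induction R with
  | zero =>
    have h : sandwich k (0 : H) T = 0 := by simp [sandwich]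
    simp [drinfeldElement, h]
  | add x y hx hy => simp [leg13_add, add_mul, hx, hy, drinfeldElement_add, sandwich_add]
  | tmul a b =>
    induction T with
    | zero => simp
    | add x y hx hy => rw [leg12_add, mul_add, map_add, hx, hy, map_add]
    | tmul c d => simp [antipodeContraction, drinfeldElement, mul_assoc]

/-- `∑ b u a = 1` for `R = ∑ a ⊗ b` and `u` the Drinfeld element. -/
theorem IsQuasitriangular.sandwich_drinfeldElement {R : H ⊗[k] H} (hR : IsQuasitriangular R) :
    sandwich k (drinfeldElement R) R = 1 := by
  have h := congrArg (antipodeContraction k H) hR.comul_right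
  rwa [antipodeContraction_lTensor_comul, antipodeContraction_leg_mul, hR.counitRight_eq_one,
    eq_comm] at h

variable {A : Type*} [Ring A] [Algebra k A]

/-- The linear map `a ⊗ b ↦ α(a) β(b)`. -/
noncomputable def placeAt (α β : H →ₐ[k] A) : H ⊗[k] H →ₗ[k] A :=
  LinearMap.mul' k A ∘ₗ TensorProduct.map α.toLinearMap β.toLinearMap

@[simp]
theorem placeAt_tmul (α β : H →ₐ[k] A) (a b : H) : placeAt α β (a ⊗ₜ[k] b) = α a * β b := by
  simp [placeAt]

theorem placeAt_one (α β : H →ₐ[k] A) : placeAt α β 1 = 1 := by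
  simp [Algebra.TensorProduct.one_def]

/-- Commuting images make `placeAt` multiplicative; `α` and `β` will later be the actions at two
different tensor factors. -/
theorem placeAt_mul {α β : H →ₐ[k] A} (h : ∀ a b, Commute (α a) (β b)) (R T : H ⊗[k] H) :
    placeAt α β (R * T) = placeAt α β R * placeAt α β T := by
  induction R with
  | zero => simp
  | add x y hx hy => simp [add_mul, hx, hy]
  | tmul a b =>
    induction T with
    | zero => simp
    | add x y hx hy => simp [mul_add, hx, hy]
    | tmul c d =>
      simp only [Algebra.TensorProduct.tmul_mul_tmul, placeAt_tmul, map_mul]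
      rw [mul_assoc, ← mul_assoc (α c), (h c b).eq]
      simp only [mul_assoc]

theorem placeAt_comm {α β : H →ₐ[k] A} (h : ∀ a b, Commute (α a) (β b)) (T : H ⊗[k] H) :
    placeAt α β (TensorProduct.comm k H H T) = placeAt β α T := by
  induction T with
  | zero => simp
  | add x y hx hy => simp [hx, hy]
  | tmul a b => simp [(h b a).eq]

theorem commute_placeAt {α β : H →ₐ[k] A} {x : A} (hα : ∀ a, Commute x (α a))
    (hβ : ∀ a, Commute x (β a)) (T : H ⊗[k] H) : Commute x (placeAt α β T) := by
  induction T with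
  | zero => simp
  | add y z hy hz => simpa using hy.add_right hz
  | tmul a b => simpa using (hα a).mul_right (hβ b)

theorem semiconj_placeAt {α β α' β' : H →ₐ[k] A} {x : A}
    (hα : ∀ a, SemiconjBy x (α a) (α' a)) (hβ : ∀ a, SemiconjBy x (β a) (β' a))
    (T : H ⊗[k] H) : SemiconjBy x (placeAt α β T) (placeAt α' β' T) := by
  induction T with
  | zero => simp
  | add y z hy hz => simpa using hy.add_right hz
  | tmul a b => simpa using (hα a).mul_right (hβ b)

theorem IsTriangular.placeAt_mul_placeAt {R : H ⊗[k] H} (hR : IsTriangular R)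
    {α β : H →ₐ[k] A} (h : ∀ a b, Commute (α a) (β b)) :
    placeAt β α R * placeAt α β R = 1 := by
  rw [← placeAt_comm h, ← placeAt_mul h, hR.flip_mul_self, placeAt_one]

/-- The linear map `a ⊗ b ↦ (∑ α(a₁) β(a₂)) γ(b)`. -/
noncomputable def placeComulAt (α β γ : H →ₐ[k] A) : H ⊗[k] H →ₗ[k] A :=
  LinearMap.mul' k A ∘ₗ TensorProduct.map (placeAt α β ∘ₗ comul (R := k)) γ.toLinearMap

@[simp]
theorem placeComulAt_tmul (α β γ : H →ₐ[k] A) (a b : H) :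
    placeComulAt α β γ (a ⊗ₜ[k] b) = placeAt α β (comul (R := k) a) * γ b := by
  simp [placeComulAt]

/-- The linear map `a ⊗ b ⊗ c ↦ α(a) β(b) γ(c)`. -/
noncomputable def placeThreeAt (α β γ : H →ₐ[k] A) : H ⊗[k] (H ⊗[k] H) →ₗ[k] A :=
  LinearMap.mul' k A ∘ₗ TensorProduct.map α.toLinearMap (placeAt β γ)

@[simp]
theorem placeThreeAt_tmul (α β γ : H →ₐ[k] A) (a : H) (T : H ⊗[k] H) :
    placeThreeAt α β γ (a ⊗ₜ[k] T) = α a * placeAt β γ T := by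
  simp [placeThreeAt]

theorem placeThreeAt_assoc (α β γ : H →ₐ[k] A) (T : H ⊗[k] H) (c : H) :
    placeThreeAt α β γ (TensorProduct.assoc k H H H (T ⊗ₜ[k] c)) = placeAt α β T * γ c := by
  induction T with
  | zero => simp
  | add x y hx hy => simp [TensorProduct.add_tmul, hx, hy, add_mul]
  | tmul a b => simp [mul_assoc]

theorem placeThreeAt_comul (α β γ : H →ₐ[k] A) (T : H ⊗[k] H) :
    placeThreeAt α β γ (TensorProduct.assoc k H H H
      ((comul (R := k) (A := H)).rTensor H T)) = placeComulAt α β γ T := by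
  induction T with
  | zero => simp
  | add x y hx hy => simp [hx, hy]
  | tmul a b => simp [placeThreeAt_assoc]

theorem placeThreeAt_leg_mul {α β γ : H →ₐ[k] A} (hβγ : ∀ a b, Commute (β a) (γ b))
    (R T : H ⊗[k] H) :
    placeThreeAt α β γ (leg13 R * leg23 T) = placeAt α γ R * placeAt β γ T := by
  induction R with
  | zero => simp
  | add x y hx hy => simp [leg13_add, add_mul, hx, hy]
  | tmul a b =>
    induction T with
    | zero => simp
    | add x y hx hy => rw [leg23_add, mul_add, map_add, hx, hy, map_add, mul_add]
    | tmul c d =>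
      simp only [leg13_tmul, leg23, Algebra.TensorProduct.tmul_mul_tmul, one_mul, mul_one,
        placeThreeAt_tmul, placeAt_tmul, map_mul]
      rw [mul_assoc, ← mul_assoc (γ b), ← (hβγ c b).eq, mul_assoc]

theorem IsQuasitriangular.placeComulAt_eq {R : H ⊗[k] H} (hR : IsQuasitriangular R)
    {α β γ : H →ₐ[k] A} (hβγ : ∀ a b, Commute (β a) (γ b)) :
    placeComulAt α β γ R = placeAt α γ R * placeAt β γ R := by
  rw [← placeThreeAt_comul, hR.comul_left, placeThreeAt_leg_mul hβγ]

/-- This is `R Δ = Δᵒᵖ R` on the first two legs, the third leg being a bystander. With the hexagon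
identity `placeComulAt_eq` on both sides it becomes Yang–Baxter. -/
theorem IsQuasitriangular.placeAt_mul_placeComulAt {R : H ⊗[k] H} (hR : IsQuasitriangular R)
    {α β γ : H →ₐ[k] A} (hαβ : ∀ a b, Commute (α a) (β b)) (hαγ : ∀ a b, Commute (α a) (γ b))
    (hβγ : ∀ a b, Commute (β a) (γ b)) (T : H ⊗[k] H) :
    placeAt α β R * placeComulAt α β γ T = placeComulAt β α γ T * placeAt α β R := by
  induction T with
  | zero => simp
  | add x y hx hy => simp [mul_add, add_mul, hx, hy]
  | tmul a b =>
    have hc : Commute (γ b) (placeAt α β R) :=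
      commute_placeAt (fun x => (hαγ x b).symm) (fun x => (hβγ x b).symm) R
    rw [placeComulAt_tmul, placeComulAt_tmul, ← mul_assoc, ← placeAt_mul hαβ, hR.intertwines,
      placeAt_mul hαβ, placeAt_comm hαβ, mul_assoc, mul_assoc, hc.eq]

/-- The quantum Yang–Baxter equation `R₁₂ R₁₃ R₂₃ = R₂₃ R₁₃ R₁₂`. -/
theorem IsQuasitriangular.yangBaxter {R : H ⊗[k] H} (hR : IsQuasitriangular R)
    {α β γ : H →ₐ[k] A} (hαβ : ∀ a b, Commute (α a) (β b)) (hαγ : ∀ a b, Commute (α a) (γ b))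
    (hβγ : ∀ a b, Commute (β a) (γ b)) :
    placeAt α β R * placeAt α γ R * placeAt β γ R =
      placeAt β γ R * placeAt α γ R * placeAt α β R := by
  rw [mul_assoc, ← hR.placeComulAt_eq hβγ, hR.placeAt_mul_placeComulAt hαβ hαγ hβγ,
    hR.placeComulAt_eq hαγ]

end HopfIdentities

/-! ### Categorical dimension as a trace -/

section CategoricalDimension

variable {k H V : Type*} [Field k] [Ring H] [HopfAlgebra k H]
  [AddCommGroup V] [Module k V] [FiniteDimensional k V]

theorem categoricalDim_eq_trace (R : H ⊗[k] H) (ρ : H →ₐ[k] Module.End k V) :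
    categoricalDim R ρ = LinearMap.trace k V (ρ (drinfeldElement R)) := by
  induction R with
  | zero => simp [categoricalDim, braiding, drinfeldElement]
  | add x y hx hy =>
    rw [drinfeldElement_add, map_add, map_add, ← hx, ← hy]
    simp [categoricalDim, braiding, LinearMap.comp_add, LinearMap.add_comp]
  | tmul a b =>
    classical
    rw [LinearMap.trace_eq_matrix_trace k (Module.Basis.ofVectorSpace k V), Matrix.trace]
    simp [categoricalDim, braiding, drinfeldElement, tensorAction, coevaluation_apply_one,
      dualRep, Module.Dual.transpose, LinearMap.toMatrix_apply]

end CategoricalDimension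

/-! ### Words in adjacent transpositions -/

section AdjacentGenerators

variable {M : Type*} [Monoid M]

/-- The submonoid generated by those `s i` that act on the first `n` strands. -/
def strandMonoid (s : ℕ → M) (n : ℕ) : Submonoid M :=
  Submonoid.closure {x | ∃ i, i + 1 < n ∧ s i = x}

theorem mem_strandMonoid (s : ℕ → M) {i n : ℕ} (h : i + 1 < n) : s i ∈ strandMonoid s n :=
  Submonoid.subset_closure ⟨i, h, rfl⟩

theorem strandMonoid_mono (s : ℕ → M) {m n : ℕ} (h : m ≤ n) :
    strandMonoid s m ≤ strandMonoid s n :=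
  Submonoid.closure_mono fun _ ⟨i, hi, hx⟩ => ⟨i, hi.trans_le h, hx⟩

theorem strandMonoid_le {s : ℕ → M} {n : ℕ} {N : Submonoid M}
    (h : ∀ i, i + 1 < n → s i ∈ N) : strandMonoid s n ≤ N :=
  (Submonoid.closure_le).2 fun _ ⟨i, hi, hx⟩ => hx ▸ h i hi

theorem strandMonoid_one (s : ℕ → M) : strandMonoid s 1 = ⊥ := by
  refine le_bot_iff.1 (strandMonoid_le fun i hi => ?_)
  omega

/-- The defining relations of the infinite symmetric group on its adjacent transpositions. -/
structure IsAdjacentSystem (s : ℕ → M) : Prop where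
  mul_self : ∀ n, s n * s n = 1
  braid : ∀ n, s (n + 1) * s n * s (n + 1) = s n * s (n + 1) * s n
  far : ∀ m n, m + 1 < n → Commute (s n) (s m)

theorem IsAdjacentSystem.commute_strandMonoid {s : ℕ → M} (hs : IsAdjacentSystem s) {n : ℕ}
    {x : M} (hx : x ∈ strandMonoid s n) : Commute (s n) x := by
  have h : strandMonoid s n ≤ Submonoid.centralizer {s n} :=
    strandMonoid_le fun i hi => by
      rw [Submonoid.mem_centralizer_iff]
      rintro _ rfl
      exact (hs.far i n hi).eq
  exact Submonoid.mem_centralizer_iff.1 (h hx) _ rfl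

/-- The decomposition `Sₙ₊₂ = Sₙ₊₁ ∪ Sₙ₊₁ sₙ Sₙ₊₁` into double cosets. -/
theorem IsAdjacentSystem.mem_or_exists {s : ℕ → M} (hs : IsAdjacentSystem s) (n : ℕ) {x : M}
    (hx : x ∈ strandMonoid s (n + 2)) :
    x ∈ strandMonoid s (n + 1) ∨
      ∃ a ∈ strandMonoid s (n + 1), ∃ b ∈ strandMonoid s (n + 1), x = a * s n * b := by
  induction n generalizing x with
  | zero =>
    induction hx using Submonoid.closure_induction_right with
    | one => exact Or.inl (one_mem _)
    | mul_right x _ y hy ih =>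
      obtain ⟨i, hi, rfl⟩ := hy
      obtain rfl : i = 0 := by omega
      rw [zero_add, strandMonoid_one] at ih ⊢
      rcases ih with h | ⟨a, ha, b, hb, rfl⟩
      · exact Or.inr ⟨x, h, 1, one_mem _, by simp⟩
      · rw [Submonoid.mem_bot] at ha hb
        subst ha hb
        left
        simp [hs.mul_self]
  | succ n ihn =>
    induction hx using Submonoid.closure_induction_right with
    | one => exact Or.inl (one_mem _)
    | mul_right x _ y hy ih =>
      obtain ⟨i, hi, rfl⟩ := hy
      rcases ih with h | ⟨a, ha, b, hb, rfl⟩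
      · rcases Nat.lt_or_ge (i + 1) (n + 2) with hi' | hi'
        · exact Or.inl (mul_mem h (mem_strandMonoid s hi'))
        · obtain rfl : i = n + 1 := by omega
          exact Or.inr ⟨x, h, 1, one_mem _, by simp⟩
      · rcases Nat.lt_or_ge (i + 1) (n + 2) with hi' | hi'
        · exact Or.inr ⟨a, ha, _, mul_mem hb (mem_strandMonoid s hi'), by simp only [mul_assoc]⟩
        · obtain rfl : i = n + 1 := by omega
          have hle := strandMonoid_mono s (Nat.le_succ (n + 1))
          -- The word is `a s₍ₙ₊₁₎ b s₍ₙ₊₁₎`. If `b` avoids `sₙ`, the two outer generators meet and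
          -- cancel; otherwise `b = c sₙ e`, and the braid relation leaves a single `s₍ₙ₊₁₎`.
          rcases ihn hb with hb' | ⟨c, hc, e, he, rfl⟩
          · left
            have hcomm := hs.commute_strandMonoid hb'
            rw [mul_assoc, mul_assoc, ← hcomm.eq, ← mul_assoc (s (n + 1)), hs.mul_self, one_mul]
            exact mul_mem ha hb
          · right
            refine ⟨_, mul_mem (mul_mem ha (hle hc)) (mem_strandMonoid s (Nat.lt_succ_self _)), _,
              mul_mem (mem_strandMonoid s (Nat.lt_succ_self _)) (hle he), ?_⟩
            have hcc := hs.commute_strandMonoid hc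
            have hce := hs.commute_strandMonoid he
            calc a * s (n + 1) * (c * s n * e) * s (n + 1)
                = a * (s (n + 1) * c) * s n * (e * s (n + 1)) := by simp only [mul_assoc]
              _ = a * c * (s (n + 1) * s n * s (n + 1)) * e := by
                  rw [hcc.eq, ← hce.eq]; simp only [mul_assoc]
              _ = a * c * s n * s (n + 1) * (s n * e) := by
                  rw [hs.braid]; simp only [mul_assoc]

end AdjacentGenerators

/-! ### Jucys–Murphy elements and their eigenvalues -/

section JucysMurphy

open Equiv MonoidAlgebra

variable (k : Type*) [Field k]

/-- The Jucys–Murphy element `∑_{i < n} (i n)` of the group algebra of `Perm ℕ`. -/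
noncomputable def jucysMurphy (n : ℕ) : MonoidAlgebra k (Perm ℕ) :=
  ∑ i ∈ Finset.range n, of k (Perm ℕ) (swap i n)

theorem conj_swap (π : Perm ℕ) (i j : ℕ) : π * swap i j = swap (π i) (π j) * π := by
  rw [mul_swap_eq_swap_mul]

theorem of_mul_jucysMurphy (n : ℕ) :
    of k (Perm ℕ) (swap n (n + 1)) * jucysMurphy k n =
      (jucysMurphy k (n + 1) - of k (Perm ℕ) (swap n (n + 1))) *
        of k (Perm ℕ) (swap n (n + 1)) := by
  rw [jucysMurphy, jucysMurphy, Finset.sum_range_succ, add_sub_cancel_right, Finset.mul_sum,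
    Finset.sum_mul]
  refine Finset.sum_congr rfl fun i hi => ?_
  have hi := Finset.mem_range.1 hi
  rw [← map_mul, ← map_mul, conj_swap, swap_apply_left,
    swap_apply_of_ne_of_ne (by omega) (by omega)]

/-- Conjugation by `π` only permutes the summands `(i n)`, since `π` fixes `n` and preserves `{0, …,
n - 1}`. -/
theorem commute_of_jucysMurphy {n : ℕ} {π : Perm ℕ} (hπ : ∀ i, n ≤ i → π i = i) :
    Commute (of k (Perm ℕ) π) (jucysMurphy k n) := by
  have hlt : ∀ (σ : Perm ℕ), (∀ i, n ≤ i → σ i = i) → ∀ i, i < n → σ i < n := by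
    intro σ hσ i hi
    by_contra! h
    have := σ.injective (hσ _ h)
    omega
  have hinv : ∀ i, n ≤ i → π⁻¹ i = i := fun i hi => by
    rw [Perm.inv_eq_iff_eq, hπ i hi]
  rw [Commute, SemiconjBy, jucysMurphy, Finset.mul_sum, Finset.sum_mul]
  refine Finset.sum_bij' (fun i _ => π i) (fun i _ => π⁻¹ i) ?_ ?_ ?_ ?_ ?_
  · exact fun i hi => Finset.mem_range.2 (hlt π hπ i (Finset.mem_range.1 hi))
  · exact fun i hi => Finset.mem_range.2 (hlt _ hinv i (Finset.mem_range.1 hi))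
  · simp
  · simp
  · intro i _
    rw [← map_mul, ← map_mul, conj_swap, hπ n le_rfl]

theorem commute_jucysMurphy_succ (n : ℕ) :
    Commute (jucysMurphy k n) (jucysMurphy k (n + 1)) := by
  refine Commute.sum_left _ _ _ fun i hi => commute_of_jucysMurphy k fun j hj => ?_
  have := Finset.mem_range.1 hi
  exact swap_apply_of_ne_of_ne (by omega) (by omega)

variable {k}

/-- The eigenvalues of the Jucys–Murphy elements are integers. -/
theorem eq_zero_of_jucysMurphy_mul_eq_smul (n : ℕ) {β : k} (hβ : ∀ m : ℤ, β ≠ m)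
    {y : MonoidAlgebra k (Perm ℕ)} (hy : jucysMurphy k n * y = β • y) : y = 0 := by
  induction n generalizing β y with
  | zero =>
    have h0 : β ≠ 0 := by simpa using hβ 0
    simpa [jucysMurphy, h0, eq_comm] using hy
  | succ n ih =>
    set a := jucysMurphy k n
    set b := jucysMurphy k (n + 1)
    set s := of k (Perm ℕ) (swap n (n + 1))
    have hss : s * s = 1 := by
      rw [← map_mul, swap_mul_self, map_one]
    have hsa : a * s = s * b - 1 := by
      have h : s * a = (b - s) * s := of_mul_jucysMurphy k n
      calc a * s = s * (s * a) * s := by rw [← mul_assoc, hss, one_mul]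
        _ = s * b * (s * s) - s * s * (s * s) := by
          rw [h]; noncomm_ring
        _ = s * b - 1 := by rw [hss, mul_one, mul_one]
    -- The relations `a s = s b - 1`, `s² = 1` and `a b = b a` are those of a degenerate affine
    -- Hecke algebra; the rest uses only these and the induction hypothesis for `a`.
    have hab : a * b = b * a := commute_jucysMurphy_succ k n
    have key : ∀ z, b * z = β • z → a * (s * z) = β • (s * z) - z := fun z hz => by
      rw [← mul_assoc, hsa, sub_mul, one_mul, mul_assoc, hz, mul_smul_comm]
    have hby : b * (a * y - β • y) = β • (a * y - β • y) := by
      rw [mul_sub, ← mul_assoc, ← hab, mul_assoc, mul_smul_comm, hy, mul_smul_comm, smul_sub]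
    -- With `w = a y - β y`, also a `β`-eigenvector of `b`, one has `a (s w) = β s w - w`; adding `a
    -- y = β y + w` shows that `a` has eigenvalue `β` on `s w + y`.
    have h1 : s * (a * y - β • y) + y = 0 := by
      refine ih hβ ?_
      rw [mul_add, key _ hby, smul_add]
      abel
    have h2 : a * y - β • y = -(s * y) := by
      have := congrArg (s * ·) (eq_neg_of_add_eq_zero_left h1)
      simpa [← mul_assoc, hss] using this
    have h3 : a * y = β • y - s * y := by
      rw [sub_eq_iff_eq_add.1 h2]; abel
    have h4 := key y hy
    -- On the span of `y` and `s y`, `a` now acts as `β - s`, so `y - s y` and `y + s y` have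
    -- eigenvalues `β + 1` and `β - 1`.
    have hplus : ∀ m : ℤ, β + 1 ≠ m := fun m hm => hβ (m - 1) (by push_cast; rw [← hm]; ring)
    have hminus : ∀ m : ℤ, β - 1 ≠ m := fun m hm => hβ (m + 1) (by push_cast; rw [← hm]; ring)
    have h5 : y - s * y = 0 := by
      refine ih hplus ?_
      rw [mul_sub, h3, h4]
      module
    have h6 : y + s * y = 0 := by
      refine ih hminus ?_
      rw [mul_add, h3, h4]
      module
    have h7 : s * y = y := (sub_eq_zero.1 h5).symm
    have h8 : a * y = (β - 1) • y := by rw [h3, h7]; module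
    exact ih hminus h8

/-- The linear map of the group algebra of `Perm ℕ` that deletes `n` from the cycle through `n`
of a permutation, and multiplies by `d` if that cycle is trivial. -/
noncomputable def deletePoint (d : k) (n : ℕ) :
    MonoidAlgebra k (Perm ℕ) →ₗ[k] MonoidAlgebra k (Perm ℕ) :=
  (MonoidAlgebra.basis (Perm ℕ) k).constr k fun σ =>
    if σ n = n then d • of k (Perm ℕ) σ else of k (Perm ℕ) (swap n (σ n) * σ)

end JucysMurphy

/-! ### Deleting a point from a permutation -/

section Deletion

open Equiv MonoidAlgebra

variable {k : Type*} [Field k]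

theorem deletePoint_of (d : k) (n : ℕ) (σ : Perm ℕ) :
    deletePoint d n (of k (Perm ℕ) σ) =
      if σ n = n then d • of k (Perm ℕ) σ else of k (Perm ℕ) (swap n (σ n) * σ) := by
  have h := (MonoidAlgebra.basis (Perm ℕ) k).constr_basis k (fun σ : Perm ℕ =>
    if σ n = n then d • of k (Perm ℕ) σ else of k (Perm ℕ) (swap n (σ n) * σ)) σ
  rwa [MonoidAlgebra.basis_apply] at h

theorem linearIndependent_of : LinearIndependent k (of k (Perm ℕ)) := by
  have h := (MonoidAlgebra.basis (Perm ℕ) k).linearIndependent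
  convert h using 1
  ext1 σ
  rw [MonoidAlgebra.basis_apply, of_apply]

theorem deletePoint_mul_swap (d : k) {n : ℕ} (σ : Perm ℕ) (j : ℕ) :
    deletePoint d n (of k (Perm ℕ) σ * of k (Perm ℕ) (swap j n)) * of k (Perm ℕ) (swap j n) =
      if σ j = n then d • of k (Perm ℕ) σ else of k (Perm ℕ) (swap (σ j) n) * of k (Perm ℕ) σ := by
  rw [← map_mul, deletePoint_of, Perm.mul_apply, swap_apply_right]
  split_ifs
  · rw [smul_mul_assoc, ← map_mul, mul_assoc, swap_mul_self, mul_one]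
  · rw [← map_mul, ← map_mul, mul_assoc, mul_assoc, swap_mul_self, mul_one, swap_comm]

/-- For a permutation `σ` the `j`-th term depends on `j` only through `σ j`: it is `d σ` when `σ j =
n` and `(σ j n) σ` otherwise. Letting `σ j` run through `0, …, n` produces `d σ` once and every
summand of the Jucys–Murphy element once. -/
theorem sum_deletePoint_mul_swap (d : k) {n : ℕ} {y : MonoidAlgebra k (Perm ℕ)}
    (hy : y ∈ Submodule.span k (of k (Perm ℕ) '' {σ | ∀ i, n + 1 ≤ i → σ i = i})) :
    ∑ j ∈ Finset.range (n + 1),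
      deletePoint d n (y * of k (Perm ℕ) (swap j n)) * of k (Perm ℕ) (swap j n) =
        d • y + jucysMurphy k n * y := by
  induction hy using Submodule.span_induction with
  | zero => simp
  | add x y _ _ hx hy =>
    simp only [add_mul, map_add, Finset.sum_add_distrib, hx, hy, mul_add, smul_add]
    abel
  | smul a x _ hx =>
    simp only [smul_mul_assoc, map_smul, mul_smul_comm, ← Finset.smul_sum, hx, smul_add]
    rw [smul_comm]
  | mem x hx =>
    obtain ⟨σ, hσ, rfl⟩ := hx
    have hlt : ∀ (τ : Perm ℕ), (∀ i, n + 1 ≤ i → τ i = i) → ∀ i, i < n + 1 → τ i < n + 1 := by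
      intro τ hτ i hi
      by_contra! h
      have := τ.injective (hτ _ h)
      omega
    have hinv : ∀ i, n + 1 ≤ i → σ⁻¹ i = i := fun i hi => by
      rw [Perm.inv_eq_iff_eq, hσ i hi]
    have hre : ∑ j ∈ Finset.range (n + 1),
        deletePoint d n (of k (Perm ℕ) σ * of k (Perm ℕ) (swap j n)) * of k (Perm ℕ) (swap j n) =
        ∑ i ∈ Finset.range (n + 1), if i = n then d • of k (Perm ℕ) σ else
          of k (Perm ℕ) (swap i n) * of k (Perm ℕ) σ := by
      refine Finset.sum_bij' (fun i _ => σ i) (fun i _ => σ⁻¹ i) ?_ ?_ ?_ ?_ ?_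
      · exact fun i hi => Finset.mem_range.2 (hlt σ hσ i (Finset.mem_range.1 hi))
      · exact fun i hi => Finset.mem_range.2 (hlt _ hinv i (Finset.mem_range.1 hi))
      · simp
      · simp
      · exact fun i _ => deletePoint_mul_swap d σ i
    rw [hre, Finset.sum_range_succ, if_pos rfl, add_comm, jucysMurphy, Finset.sum_mul]
    congr 1
    exact Finset.sum_congr rfl fun i hi => if_neg (Finset.mem_range.1 hi).ne

end Deletion

/-! ### Finite symmetric groups inside `Perm ℕ` -/

section AdjacentTranspositions

open Equiv

/-- The adjacent transposition `(n n+1)`. -/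
def adjacentSwap (n : ℕ) : Perm ℕ := swap n (n + 1)

theorem isAdjacentSystem_adjacentSwap : IsAdjacentSystem adjacentSwap where
  mul_self n := swap_mul_self _ _
  braid n := by
    -- Both sides of the braid relation equal the transposition `(n n+2)`.
    have h1 := conj_swap (swap (n + 1) (n + 2)) n (n + 1)
    have h2 := conj_swap (swap n (n + 1)) (n + 1) (n + 2)
    rw [swap_apply_left, swap_apply_of_ne_of_ne (by omega) (by omega)] at h1
    rw [swap_apply_right, swap_apply_of_ne_of_ne (by omega) (by omega)] at h2
    simp only [adjacentSwap]
    rw [h1, h2, mul_assoc, mul_assoc, swap_mul_self, swap_mul_self]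
  far m n h := by
    have h1 := conj_swap (adjacentSwap n) m (m + 1)
    rwa [adjacentSwap, swap_apply_of_ne_of_ne (by omega) (by omega),
      swap_apply_of_ne_of_ne (by omega) (by omega)] at h1

theorem apply_eq_of_mem_strandMonoid {n : ℕ} {σ : Perm ℕ}
    (hσ : σ ∈ strandMonoid adjacentSwap n) {i : ℕ} (hi : n ≤ i) : σ i = i := by
  induction hσ using Submonoid.closure_induction with
  | one => rfl
  | mul x y _ _ hx hy => rw [Perm.mul_apply, hy, hx]
  | mem x hx =>
    obtain ⟨j, hj, rfl⟩ := hx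
    exact swap_apply_of_ne_of_ne (by omega) (by omega)

theorem swap_mem_strandMonoid {i n : ℕ} (h : i ≤ n) :
    swap i n ∈ strandMonoid adjacentSwap (n + 1) := by
  induction n, h using Nat.le_induction with
  | base => rw [swap_self]; exact one_mem _
  | succ n hn ih =>
    have hs : adjacentSwap n ∈ strandMonoid adjacentSwap (n + 2) :=
      mem_strandMonoid _ (Nat.lt_succ_self _)
    rcases hn.eq_or_lt with rfl | hlt
    · exact hs
    · have h : adjacentSwap n * swap i n * adjacentSwap n = swap i (n + 1) := by
        rw [conj_swap, mul_assoc, adjacentSwap, swap_mul_self, mul_one, swap_apply_left,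
          swap_apply_of_ne_of_ne (by omega) (by omega)]
      rw [← h]
      exact mul_mem (mul_mem hs (strandMonoid_mono _ (Nat.le_succ _) ih)) hs

theorem viaEmbedding_mem_strandMonoid {n : ℕ} (σ : Perm (Fin n)) :
    Perm.viaEmbeddingHom Fin.valEmbedding σ ∈ strandMonoid adjacentSwap n := by
  rcases n with _ | n
  · rw [Subsingleton.elim σ 1, map_one]
    exact one_mem _
  · have hσ : σ ∈ Submonoid.closure
        (Set.range fun i : Fin n => swap i.castSucc i.succ) := by
      rw [Perm.mclosure_swap_castSucc_succ]; trivial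
    induction hσ using Submonoid.closure_induction with
    | one => rw [map_one]; exact one_mem _
    | mul x y _ _ hx hy => rw [map_mul]; exact mul_mem hx hy
    | mem x hx =>
      obtain ⟨i, rfl⟩ := hx
      have h : Perm.viaEmbeddingHom Fin.valEmbedding (swap i.castSucc i.succ) =
          adjacentSwap i := by
        ext m
        rw [Perm.viaEmbeddingHom_apply]
        by_cases hm : m < n + 1
        · have := Perm.viaEmbedding_apply (swap i.castSucc i.succ) Fin.valEmbedding ⟨m, hm⟩
          simp only [Fin.valEmbedding_apply] at this
          rw [this, adjacentSwap, swap_apply_def, swap_apply_def]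
          simp only [Fin.ext_iff, Fin.val_castSucc, Fin.val_succ]
          split_ifs <;> rfl
        · rw [Perm.viaEmbedding_apply_of_notMem _ _ _ (by simpa using hm), adjacentSwap,
            swap_apply_of_ne_of_ne (by omega) (by omega)]
      rw [h]
      exact mem_strandMonoid _ (by omega)

end AdjacentTranspositions

/-! ### Faithfulness when the loop value is not an integer -/

section MarkovTrace

open Equiv MonoidAlgebra

variable {k A : Type*} [Field k] [Ring A] [Algebra k A]

/-- A symmetric-group system `s` together with partial traces `E n` that remove the strand `n`,
with loop value `d`. -/
structure IsMarkovSystem (s : ℕ → A) (E : ℕ → A →ₗ[k] A) (d : k) : Prop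
    extends IsAdjacentSystem s where
  partialTrace : ∀ n, ∀ x ∈ strandMonoid s n, E n x = d • x
  partialTrace_mul : ∀ n, ∀ a ∈ strandMonoid s (n + 1), ∀ b ∈ strandMonoid s (n + 1),
    E (n + 1) (a * s n * b) = a * b

/-- The diagonal system in `A × Perm ℕ`. -/
def pairSystem (s : ℕ → A) (n : ℕ) : A × Perm ℕ := (s n, adjacentSwap n)

theorem IsAdjacentSystem.pairSystem {s : ℕ → A} (hs : IsAdjacentSystem s) :
    IsAdjacentSystem (pairSystem s) where
  mul_self n := Prod.ext (hs.mul_self n) (isAdjacentSystem_adjacentSwap.mul_self n)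
  braid n := Prod.ext (hs.braid n) (isAdjacentSystem_adjacentSwap.braid n)
  far m n h := Prod.ext (hs.far m n h) (isAdjacentSystem_adjacentSwap.far m n h)

theorem fst_mem_strandMonoid {s : ℕ → A} {n : ℕ} {x : A × Perm ℕ}
    (hx : x ∈ strandMonoid (pairSystem s) n) : x.1 ∈ strandMonoid s n := by
  have h : strandMonoid (pairSystem s) n ≤ (strandMonoid s n).comap (MonoidHom.fst A (Perm ℕ)) :=
    strandMonoid_le fun i hi => mem_strandMonoid s hi
  exact h hx

theorem snd_mem_strandMonoid {s : ℕ → A} {n : ℕ} {x : A × Perm ℕ}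
    (hx : x ∈ strandMonoid (pairSystem s) n) : x.2 ∈ strandMonoid adjacentSwap n := by
  have h : strandMonoid (pairSystem s) n ≤
      (strandMonoid adjacentSwap n).comap (MonoidHom.snd A (Perm ℕ)) :=
    strandMonoid_le fun i hi => mem_strandMonoid adjacentSwap hi
  exact h hx

/-- Pairing each generator with its transposition replaces a homomorphism from the symmetric group
to `A`: a lift of `σ` is a word for `σ` evaluated on both sides, and no Coxeter presentation is
needed. -/
theorem exists_lift_strandMonoid (s : ℕ → A) {n : ℕ} {σ : Perm ℕ}
    (hσ : σ ∈ strandMonoid adjacentSwap n) : ∃ x ∈ strandMonoid (pairSystem s) n, x.2 = σ := by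
  have h : strandMonoid adjacentSwap n ≤
      (strandMonoid (pairSystem s) n).map (MonoidHom.snd A (Perm ℕ)) :=
    strandMonoid_le fun i hi => ⟨_, mem_strandMonoid (pairSystem s) hi, rfl⟩
  exact h hσ

/-- Linearization of the second component. -/
noncomputable def linearizeSnd (k A : Type*) [Field k] [Ring A] :
    A × Perm ℕ →* A × MonoidAlgebra k (Perm ℕ) :=
  (MonoidHom.id A).prodMap (of k (Perm ℕ))

variable (k) in
/-- The linear span of the diagonal system on `n` strands. -/
noncomputable def pairSpan (s : ℕ → A) (n : ℕ) : Submodule k (A × MonoidAlgebra k (Perm ℕ)) :=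
  Submodule.span k (linearizeSnd k A '' strandMonoid (pairSystem s) n)

theorem mul_mem_pairSpan {s : ℕ → A} {n : ℕ} {x : A × MonoidAlgebra k (Perm ℕ)}
    (hx : x ∈ pairSpan k s n) {y : A × Perm ℕ} (hy : y ∈ strandMonoid (pairSystem s) n) :
    x * linearizeSnd k A y ∈ pairSpan k s n := by
  induction hx using Submodule.span_induction with
  | zero => rw [zero_mul]; exact zero_mem _
  | add a b _ _ ha hb => rw [add_mul]; exact add_mem ha hb
  | smul c a _ ha => rw [smul_mul_assoc]; exact Submodule.smul_mem _ _ ha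
  | mem a ha =>
    obtain ⟨b, hb, rfl⟩ := ha
    rw [← map_mul]
    exact Submodule.subset_span ⟨_, mul_mem hb hy, rfl⟩

theorem snd_mem_span {s : ℕ → A} {n : ℕ} {x : A × MonoidAlgebra k (Perm ℕ)}
    (hx : x ∈ pairSpan k s n) :
    x.2 ∈ Submodule.span k (of k (Perm ℕ) '' {σ | ∀ i, n ≤ i → σ i = i}) := by
  induction hx using Submodule.span_induction with
  | zero => exact zero_mem _
  | add a b _ _ ha hb => exact add_mem ha hb
  | smul c a _ ha => exact Submodule.smul_mem _ _ ha
  | mem a ha =>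
    obtain ⟨b, hb, rfl⟩ := ha
    exact Submodule.subset_span
      ⟨b.2, fun i hi => apply_eq_of_mem_strandMonoid (snd_mem_strandMonoid hb) hi, rfl⟩

variable {s : ℕ → A} {E : ℕ → A →ₗ[k] A} {d : k}

theorem IsMarkovSystem.partialTrace_mem_pairSpan_of_mem (h : IsMarkovSystem s E d) {n : ℕ}
    {x : A × Perm ℕ} (hx : x ∈ strandMonoid (pairSystem s) n) :
    (E n x.1, deletePoint d n (of k (Perm ℕ) x.2)) ∈ pairSpan k s n := by
  rw [deletePoint_of, if_pos (apply_eq_of_mem_strandMonoid (snd_mem_strandMonoid hx) le_rfl),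
    h.partialTrace n _ (fst_mem_strandMonoid hx)]
  have hmem : linearizeSnd k A x ∈ pairSpan k s n := Submodule.subset_span ⟨x, hx, rfl⟩
  exact Submodule.smul_mem _ d hmem

/-- The partial trace on operators matches point deletion on permutations. By the double coset
decomposition it suffices to treat words without the last generator, where a factor `d` appears on
both sides, and words `a sₙ b`, where both sides give `a b`. -/
theorem IsMarkovSystem.partialTrace_mem_pairSpan (h : IsMarkovSystem s E d) {n : ℕ}
    {x : A × MonoidAlgebra k (Perm ℕ)} (hx : x ∈ pairSpan k s (n + 1)) :
    (E n x.1, deletePoint d n x.2) ∈ pairSpan k s n := by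
  induction hx using Submodule.span_induction with
  | zero => simp only [Prod.fst_zero, Prod.snd_zero, map_zero]; exact zero_mem _
  | add a b _ _ ha hb =>
    simp only [Prod.fst_add, Prod.snd_add, map_add]; exact add_mem ha hb
  | smul c a _ ha =>
    simp only [Prod.smul_fst, Prod.smul_snd, map_smul]; exact Submodule.smul_mem _ c ha
  | mem y hy =>
    obtain ⟨x, hx, rfl⟩ := hy
    change (E n x.1, deletePoint d n (of k (Perm ℕ) x.2)) ∈ _
    rcases n with _ | n
    · rw [SetLike.mem_coe, zero_add, strandMonoid_one, Submonoid.mem_bot] at hx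
      subst hx
      exact h.partialTrace_mem_pairSpan_of_mem (one_mem _)
    · rcases h.toIsAdjacentSystem.pairSystem.mem_or_exists n hx with hx | ⟨a, ha, b, hb, rfl⟩
      · exact h.partialTrace_mem_pairSpan_of_mem hx
      · have hfix : ∀ i, n + 1 ≤ i → b.2 i = i := fun i hi =>
          apply_eq_of_mem_strandMonoid (snd_mem_strandMonoid hb) hi
        have hfix' : ∀ i, n + 1 ≤ i → a.2 i = i := fun i hi =>
          apply_eq_of_mem_strandMonoid (snd_mem_strandMonoid ha) hi
        have hval : (a * pairSystem s n * b).2 (n + 1) = a.2 n := by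
          change a.2 (swap n (n + 1) (b.2 (n + 1))) = _
          rw [hfix _ le_rfl, swap_apply_right]
        have hne : a.2 n ≠ n + 1 := fun he => by
          have := a.2.injective (he.trans (hfix' _ le_rfl).symm)
          omega
        have hdel : swap (n + 1) (a.2 n) * (a * pairSystem s n * b).2 = (a * b).2 := by
          change _ * (a.2 * swap n (n + 1) * b.2) = a.2 * b.2
          rw [conj_swap, hfix' _ le_rfl, swap_comm, ← mul_assoc, ← mul_assoc, swap_mul_self,
            one_mul]
        rw [deletePoint_of, hval, if_neg hne, hdel]
        change (E (n + 1) (a.1 * s n * b.1), _) ∈ _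
        rw [h.partialTrace_mul n _ (fst_mem_strandMonoid ha) _ (fst_mem_strandMonoid hb)]
        exact Submodule.subset_span ⟨a * b, mul_mem ha hb, rfl⟩

/-- This is faithfulness: a combination of words vanishing in `A` already vanishes in the group
algebra. -/
theorem IsMarkovSystem.snd_eq_zero [Nontrivial A] (h : IsMarkovSystem s E d)
    (hd : ∀ m : ℤ, d ≠ m) (n : ℕ) {x : A × MonoidAlgebra k (Perm ℕ)} (hx : x ∈ pairSpan k s n)
    (hx0 : x.1 = 0) : x.2 = 0 := by
  induction n generalizing x with
  | zero =>
    have hbot : strandMonoid (pairSystem s) 0 = ⊥ :=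
      le_bot_iff.1 (strandMonoid_le fun i hi => by omega)
    rw [pairSpan, hbot, Submonoid.coe_bot, Set.image_singleton, map_one,
      Submodule.mem_span_singleton] at hx
    obtain ⟨c, rfl⟩ := hx
    have hc : c = 0 := (smul_eq_zero.1 hx0).resolve_right one_ne_zero
    rw [hc, zero_smul, Prod.snd_zero]
  | succ n ih =>
    refine eq_zero_of_jucysMurphy_mul_eq_smul n (β := -d)
      (fun m hm => hd (-m) (by push_cast; rw [← hm, neg_neg])) ?_
    have hsum := sum_deletePoint_mul_swap d (snd_mem_span hx)
    rw [Finset.sum_eq_zero, eq_comm, add_comm] at hsum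
    · rw [eq_neg_of_add_eq_zero_left hsum, neg_smul]
    -- Each deletion of `x (j n)` is the second component of a pair on `n` strands whose first
    -- component is `E n 0 = 0`, so the induction hypothesis kills it.
    · intro j hj
      obtain ⟨y, hy, hyj⟩ := exists_lift_strandMonoid s
        (swap_mem_strandMonoid (Nat.lt_succ_iff.1 (Finset.mem_range.1 hj)))
      have h0 := ih (h.partialTrace_mem_pairSpan (mul_mem_pairSpan hx hy)) (by
        change E n (x.1 * y.1) = 0
        rw [hx0, zero_mul, map_zero])
      change deletePoint d n (x.2 * of k (Perm ℕ) y.2) = 0 at h0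
      rw [hyj] at h0
      rw [h0, zero_mul]

theorem IsMarkovSystem.factorial_le_finrank [Nontrivial A] (h : IsMarkovSystem s E d)
    (hd : ∀ m : ℤ, d ≠ m) (n : ℕ) (D : Submodule k A) [FiniteDimensional k D]
    (hD : ∀ x ∈ strandMonoid s n, x ∈ D) : n.factorial ≤ Module.finrank k D := by
  choose f hf hf2 using fun σ : Perm (Fin n) =>
    exists_lift_strandMonoid s (viaEmbedding_mem_strandMonoid σ)
  have hli : LinearIndependent k fun σ => (⟨(f σ).1, hD _ (fst_mem_strandMonoid (hf σ))⟩ : D) := by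
    rw [Fintype.linearIndependent_iff]
    intro c hc
    have hind : LinearIndependent k fun σ : Perm (Fin n) =>
        of k (Perm ℕ) (Perm.viaEmbeddingHom Fin.valEmbedding σ) :=
      linearIndependent_of.comp _ (Perm.viaEmbeddingHom_injective _)
    refine Fintype.linearIndependent_iff.1 hind c ?_
    have hmem : ∑ σ, c σ • linearizeSnd k A (f σ) ∈ pairSpan k s n :=
      sum_mem fun σ _ => Submodule.smul_mem _ _ (Submodule.subset_span ⟨_, hf σ, rfl⟩)
    have h1 : (∑ σ, c σ • linearizeSnd k A (f σ)).1 = 0 := by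
      have h0 := congrArg (D.subtype) hc
      rw [map_sum] at h0
      rw [Prod.fst_sum]
      exact h0
    have h2 := h.snd_eq_zero hd n hmem h1
    rw [Prod.snd_sum] at h2
    rw [← h2]
    exact Finset.sum_congr rfl fun σ _ => by rw [← hf2 σ]; rfl
  simpa [Fintype.card_perm] using hli.fintype_card_le_finrank

theorem exists_pow_lt_factorial (q : ℕ) : ∃ n : ℕ, q ^ n < n.factorial := by
  have h := (FloorSemiring.tendsto_pow_div_factorial_atTop (q : ℝ)).eventually_lt_const one_pos
  obtain ⟨n, hn⟩ := h.exists
  rw [div_lt_one (by positivity)] at hn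
  exact ⟨n, by exact_mod_cast hn⟩

/-- If the strands span spaces of at most exponential dimension, the loop value is an integer. -/
theorem IsMarkovSystem.exists_int_eq [Nontrivial A] (h : IsMarkovSystem s E d) (q : ℕ)
    (hq : ∀ n, ∃ D : Submodule k A, FiniteDimensional k D ∧ Module.finrank k D ≤ q ^ n ∧
      ∀ x ∈ strandMonoid s n, x ∈ D) : ∃ m : ℤ, d = m := by
  by_contra! hd
  obtain ⟨n, hn⟩ := exists_pow_lt_factorial q
  obtain ⟨D, _, hD, hmem⟩ := hq n
  exact absurd ((h.factorial_le_finrank hd n D hmem).trans hD) hn.not_ge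

end MarkovTrace

/-! ### Local operators on infinitely many sites -/

section SiteOperators

open Equiv

variable (k ι : Type*) [Field k] [Fintype ι] [DecidableEq ι]

/-- Operators on functions of infinitely many `ι`-valued sites. -/
abbrev SiteOperator : Type _ := Module.End k ((ℕ → ι) → k)

variable {k ι}

/-- A matrix acting at site `n`. -/
noncomputable def siteHom (n : ℕ) : Matrix ι ι k →ₐ[k] SiteOperator k ι :=
  AlgHom.ofLinearMap
    { toFun := fun X =>
        { toFun := fun f w => ∑ b, X (w n) b * f (Function.update w n b)
          map_add' := fun f g => by
            ext w; simp [mul_add, Finset.sum_add_distrib]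
          map_smul' := fun c f => by
            ext w; simp [Finset.mul_sum, mul_left_comm] }
      map_add' := fun X Y => by
        ext f w; simp [add_mul, Finset.sum_add_distrib]
      map_smul' := fun c X => by
        ext f w; simp [Finset.mul_sum, mul_assoc] }
    (by
      ext f w
      simp [Matrix.one_apply])
    (by
      intro X Y
      ext f w
      simp only [LinearMap.coe_mk, AddHom.coe_mk, Matrix.mul_apply, Module.End.mul_apply,
        Function.update_self, Function.update_idem, Finset.sum_mul, Finset.mul_sum, mul_assoc]
      exact Finset.sum_comm)

theorem siteHom_apply (n : ℕ) (X : Matrix ι ι k) (f : (ℕ → ι) → k) (w : ℕ → ι) :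
    siteHom n X f w = ∑ b, X (w n) b * f (Function.update w n b) := rfl

theorem siteHom_single_apply (n : ℕ) (a b : ι) (f : (ℕ → ι) → k) (w : ℕ → ι) :
    siteHom n (Matrix.single a b (1 : k)) f w =
      if w n = a then f (Function.update w n b) else 0 := by
  rw [siteHom_apply]
  split_ifs with h
  · simp [Matrix.single_apply, h]
  · simp [Ne.symm h]

theorem commute_siteHom {m n : ℕ} (h : m ≠ n) (X Y : Matrix ι ι k) :
    Commute (siteHom m X) (siteHom n Y) := by
  refine LinearMap.ext fun f => funext fun w => ?_
  simp only [Module.End.mul_apply, siteHom_apply, Function.update_of_ne h.symm,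
    Function.update_of_ne h, Finset.mul_sum]
  rw [Finset.sum_comm]
  refine Finset.sum_congr rfl fun b _ => Finset.sum_congr rfl fun c _ => ?_
  rw [Function.update_comm h, mul_left_comm]

variable (k ι) in
/-- Permutations of the sites. -/
noncomputable def sitePerm : Perm ℕ →* SiteOperator k ι where
  toFun π :=
    { toFun := fun f w => f (w ∘ π)
      map_add' := fun _ _ => rfl
      map_smul' := fun _ _ => rfl }
  map_one' := rfl
  map_mul' _ _ := rfl

omit [Fintype ι] [DecidableEq ι] in
theorem sitePerm_apply (π : Perm ℕ) (f : (ℕ → ι) → k) (w : ℕ → ι) :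
    sitePerm k ι π f w = f (w ∘ π) := rfl

theorem semiconj_sitePerm (π : Perm ℕ) (n : ℕ) (X : Matrix ι ι k) :
    SemiconjBy (sitePerm k ι π) (siteHom n X) (siteHom (π n) X) := by
  refine LinearMap.ext fun f => funext fun w => ?_
  simp only [Module.End.mul_apply, siteHom_apply, sitePerm_apply, Function.comp_apply]
  refine Finset.sum_congr rfl fun b _ => ?_
  congr 2
  ext i
  simp [Function.update_apply]

/-- The flip is `∑ E_ab ⊗ E_ba`. This makes it a local operator and lets its partial trace be
computed. -/
theorem sitePerm_adjacentSwap (n : ℕ) :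
    sitePerm k ι (adjacentSwap n) =
      ∑ a, ∑ b, siteHom n (Matrix.single a b 1) * siteHom (n + 1) (Matrix.single b a 1) := by
  refine LinearMap.ext fun f => funext fun w => ?_
  simp only [LinearMap.sum_apply, Finset.sum_apply, Module.End.mul_apply, siteHom_single_apply,
    sitePerm_apply]
  rw [Finset.sum_eq_single (w n) (fun a _ ha => by simp [Ne.symm ha]) (by simp),
    Finset.sum_eq_single (w (n + 1)) (fun b _ hb => by simp [Ne.symm hb]) (by simp),
    if_pos rfl, if_pos (by simp)]
  congr 1
  ext i
  simp only [Function.comp_apply, adjacentSwap, swap_apply_def, Function.update_apply]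
  split_ifs <;> first | rfl | omega

/-- The partial trace at site `n`, weighted by the matrix `u`. -/
noncomputable def sitePartialTrace (u : Matrix ι ι k) (n : ℕ) :
    SiteOperator k ι →ₗ[k] SiteOperator k ι :=
  ∑ a, ∑ b, ∑ c, u b a • (LinearMap.mulLeft k (siteHom n (Matrix.single c a 1)) ∘ₗ
    LinearMap.mulRight k (siteHom n (Matrix.single b c 1)))

theorem sitePartialTrace_apply (u : Matrix ι ι k) (n : ℕ) (X : SiteOperator k ι) :
    sitePartialTrace u n X = ∑ a, ∑ b, ∑ c, u b a •
      (siteHom n (Matrix.single c a 1) * X * siteHom n (Matrix.single b c 1)) := by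
  simp [sitePartialTrace, LinearMap.sum_apply, mul_assoc]

theorem sitePartialTrace_mul_mul (u : Matrix ι ι k) {n : ℕ} {a b : SiteOperator k ι}
    (ha : ∀ Y, Commute a (siteHom n Y)) (hb : ∀ Y, Commute b (siteHom n Y))
    (X : SiteOperator k ι) :
    sitePartialTrace u n (a * X * b) = a * sitePartialTrace u n X * b := by
  simp only [sitePartialTrace_apply, Finset.mul_sum, Finset.sum_mul, mul_smul_comm,
    smul_mul_assoc]
  refine Finset.sum_congr rfl fun x _ => Finset.sum_congr rfl fun y _ =>
    Finset.sum_congr rfl fun z _ => ?_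
  congr 1
  rw [← mul_assoc, ← mul_assoc, ← (ha _).eq, mul_assoc _ b, (hb _).eq]
  simp only [mul_assoc]

/-- `E_ca Y E_bc = Y_ab E_cc`, and the `E_cc` sum to the identity. -/
theorem sitePartialTrace_siteHom (u : Matrix ι ι k) (n : ℕ) (Y : Matrix ι ι k) :
    sitePartialTrace u n (siteHom n Y) = (u * Y).trace • 1 := by
  have h1 : ∑ c : ι, Matrix.single c c (1 : k) = 1 := by
    rw [← Matrix.diagonal_one, ← Matrix.sum_single_eq_diagonal]
  have h2 : ∀ a b c : ι, u b a • (siteHom n (Matrix.single c a 1) * siteHom n Y *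
      siteHom n (Matrix.single b c 1)) = (u b a * Y a b) • siteHom n (Matrix.single c c (1 : k)) := by
    intro a b c
    rw [← map_mul, ← map_mul, Matrix.single_mul_mul_single, one_mul, mul_one, ← map_smul,
      ← map_smul, Matrix.smul_single, Matrix.smul_single, smul_eq_mul, smul_eq_mul, mul_one]
  rw [sitePartialTrace_apply]
  simp only [h2, ← Finset.smul_sum, ← map_sum, h1, map_one, ← Finset.sum_smul]
  rw [Finset.sum_comm]
  simp [Matrix.trace, Matrix.mul_apply]

theorem sitePartialTrace_swap_mul (u : Matrix ι ι k) (n : ℕ) (X Y : Matrix ι ι k) :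
    sitePartialTrace u (n + 1) (sitePerm k ι (adjacentSwap n) * (siteHom n X * siteHom (n + 1) Y)) =
      siteHom n (Y * u * X) := by
  have hne : n ≠ n + 1 := (Nat.lt_succ_self n).ne
  have h : ∀ a b : ι, sitePartialTrace u (n + 1) (siteHom n (Matrix.single a b 1) *
      siteHom (n + 1) (Matrix.single b a 1) * (siteHom n X * siteHom (n + 1) Y)) =
      siteHom n (Matrix.single a b ((Y * u) a b) * X) := by
    intro a b
    have h1 : siteHom n (Matrix.single a b 1) * siteHom (n + 1) (Matrix.single b a 1) *
        (siteHom n X * siteHom (n + 1) Y) =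
        siteHom n (Matrix.single a b 1 * X) * siteHom (n + 1) (Matrix.single b a 1 * Y) * 1 := by
      rw [mul_assoc, ← mul_assoc (siteHom (n + 1) _), ← (commute_siteHom hne _ _).eq, map_mul,
        map_mul, mul_one]
      simp only [mul_assoc]
    rw [h1, sitePartialTrace_mul_mul u (fun Z => commute_siteHom hne _ _)
      (fun Z => Commute.one_left _), sitePartialTrace_siteHom, mul_one, mul_smul_comm, mul_one,
      ← map_smul, ← Matrix.smul_mul, Matrix.smul_single, smul_eq_mul, mul_one]
    congr 3
    rw [Matrix.trace_mul_comm, mul_assoc, Matrix.trace_single_mul, one_smul]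
  rw [sitePerm_adjacentSwap]
  simp only [Finset.sum_mul, map_sum, h]
  simp only [← map_sum, ← Finset.sum_mul, ← Matrix.matrix_eq_sum_single]

omit [Fintype ι] [DecidableEq ι] in
-- Since `D` commutes with the image of `φ`, multiplication `D ⊗ B → A` is an algebra map; its range
-- is the required subalgebra.
theorem exists_subalgebra_sup_range {A B : Type*} [Ring A] [Algebra k A] [Ring B] [Algebra k B]
    [FiniteDimensional k B] (D : Subalgebra k A) [FiniteDimensional k D] (φ : B →ₐ[k] A)
    (h : ∀ y, ∀ x ∈ D, Commute x (φ y)) :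
    ∃ D' : Subalgebra k A, FiniteDimensional k D' ∧
      Module.finrank k D' ≤ Module.finrank k D * Module.finrank k B ∧ D ≤ D' ∧
      (∀ y, φ y ∈ D') ∧
      ∀ z, (∀ x ∈ D, Commute x z) → (∀ y, Commute (φ y) z) → ∀ x ∈ D', Commute x z := by
  let ψ : D ⊗[k] B →ₐ[k] A := Algebra.TensorProduct.lift D.val φ fun x y => h y x x.2
  have hψ : ∀ x y, ψ (x ⊗ₜ y) = x * φ y := fun x y => Algebra.TensorProduct.lift_tmul _ _ _ x y
  refine ⟨ψ.range, inferInstanceAs (FiniteDimensional k ψ.toLinearMap.range), ?_, ?_, ?_, ?_⟩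
  · rw [← Module.finrank_tensorProduct]
    exact LinearMap.finrank_range_le ψ.toLinearMap
  · exact fun x hx => ⟨⟨x, hx⟩ ⊗ₜ 1, (hψ _ _).trans (by rw [map_one, mul_one])⟩
  · exact fun y => ⟨1 ⊗ₜ y, (hψ _ _).trans (one_mul _)⟩
  · rintro z hD hφ _ ⟨t, rfl⟩
    change Commute (ψ t) z
    induction t with
    | zero => rw [map_zero]; exact Commute.zero_left z
    | add x y hx hy => rw [map_add]; exact hx.add_left hy
    | tmul x y =>
      rw [hψ]
      exact (hD _ x.2).mul_left (hφ y)

variable (k ι) in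
/-- The operators acting on the first `n` sites form a subalgebra of dimension at most `(N²)ⁿ`,
where `N` is the number of states of a site. -/
theorem exists_subalgebra_siteHom (n : ℕ) :
    ∃ D : Subalgebra k (SiteOperator k ι), FiniteDimensional k D ∧
      Module.finrank k D ≤ (Fintype.card ι * Fintype.card ι) ^ n ∧
      (∀ i < n, ∀ X, siteHom i X ∈ D) ∧
      ∀ i, n ≤ i → ∀ X, ∀ x ∈ D, Commute x (siteHom i X) := by
  induction n with
  | zero =>
    refine ⟨⊥, inferInstance, ?_, by simp, ?_⟩
    · rw [pow_zero]
      rcases subsingleton_or_nontrivial (SiteOperator k ι) with h | h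
      · rw [Module.finrank_zero_of_subsingleton]; exact zero_le_one
      · exact (Subalgebra.finrank_bot).le
    · intro i _ X x hx
      obtain ⟨c, rfl⟩ := Algebra.mem_bot.1 hx
      exact Algebra.commutes _ _
  | succ n ih =>
    obtain ⟨D, hfin, hD, hmem, hcomm⟩ := ih
    obtain ⟨D', hfin', hD', hle, hrange, hcomm'⟩ :=
      exists_subalgebra_sup_range D (siteHom n) fun X x hx => hcomm n le_rfl X x hx
    refine ⟨D', hfin', ?_, ?_, ?_⟩
    · rw [Module.finrank_matrix, Module.finrank_self, mul_one] at hD'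
      exact hD'.trans (pow_succ (Fintype.card ι * Fintype.card ι) n ▸ Nat.mul_le_mul_right _ hD)
    · intro i hi X
      rcases (Nat.lt_succ_iff.1 hi).lt_or_eq with h | rfl
      · exact hle (hmem i h X)
      · exact hrange X
    · exact fun i hi X x hx => hcomm' _ (fun y hy => hcomm i (Nat.le_of_succ_le hi) X y hy)
        (fun Y => commute_siteHom (Nat.lt_of_succ_le hi).ne _ _) x hx

end SiteOperators

/-! ### The braidings as adjacent generators -/

section BraidSystem

open Equiv

variable {k H ι : Type*} [Field k] [Ring H] [HopfAlgebra k H] [Fintype ι] [DecidableEq ι]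

/-- A matrix representation acting at site `n`. -/
noncomputable def siteRep (ρ : H →ₐ[k] Matrix ι ι k) (n : ℕ) : H →ₐ[k] SiteOperator k ι :=
  (siteHom n).comp ρ

/-- The commutativity constraint acting on the sites `n` and `n + 1`. -/
noncomputable def siteBraiding (R : H ⊗[k] H) (ρ : H →ₐ[k] Matrix ι ι k) (n : ℕ) :
    SiteOperator k ι :=
  sitePerm k ι (adjacentSwap n) * placeAt (siteRep ρ n) (siteRep ρ (n + 1)) R

theorem commute_siteRep (ρ : H →ₐ[k] Matrix ι ι k) {m n : ℕ} (h : m ≠ n) (a b : H) :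
    Commute (siteRep ρ m a) (siteRep ρ n b) :=
  commute_siteHom h _ _

theorem sitePerm_mul_placeAt (ρ : H →ₐ[k] Matrix ι ι k) (π : Perm ℕ) {m n m' n' : ℕ}
    (hm : π m = m') (hn : π n = n') (R : H ⊗[k] H) :
    sitePerm k ι π * placeAt (siteRep ρ m) (siteRep ρ n) R =
      placeAt (siteRep ρ m') (siteRep ρ n') R * sitePerm k ι π := by
  subst hm hn
  exact semiconj_placeAt (fun a => semiconj_sitePerm π m _) (fun a => semiconj_sitePerm π n _) R

theorem adjacentSwap_left (n : ℕ) : adjacentSwap n n = n + 1 := swap_apply_left _ _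

theorem adjacentSwap_right (n : ℕ) : adjacentSwap n (n + 1) = n := swap_apply_right _ _

theorem adjacentSwap_of_ne {n i : ℕ} (h : i ≠ n) (h' : i ≠ n + 1) : adjacentSwap n i = i :=
  swap_apply_of_ne_of_ne h h'

theorem siteBraiding_eq (R : H ⊗[k] H) (ρ : H →ₐ[k] Matrix ι ι k) (n : ℕ) :
    siteBraiding R ρ n =
      placeAt (siteRep ρ (n + 1)) (siteRep ρ n) R * sitePerm k ι (adjacentSwap n) :=
  sitePerm_mul_placeAt ρ _ (adjacentSwap_left n) (adjacentSwap_right n) R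

theorem siteBraiding_mul_self {R : H ⊗[k] H} (hR : IsTriangular R)
    (ρ : H →ₐ[k] Matrix ι ι k) (n : ℕ) : siteBraiding R ρ n * siteBraiding R ρ n = 1 := by
  nth_rw 1 [siteBraiding_eq]
  rw [siteBraiding, mul_assoc, ← mul_assoc (sitePerm k ι _), ← map_mul,
    isAdjacentSystem_adjacentSwap.mul_self, map_one, one_mul]
  exact hR.placeAt_mul_placeAt (commute_siteRep ρ (Nat.lt_succ_self n).ne)

theorem siteBraiding_braid {R : H ⊗[k] H} (hR : IsTriangular R)
    (ρ : H →ₐ[k] Matrix ι ι k) (n : ℕ) :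
    siteBraiding R ρ (n + 1) * siteBraiding R ρ n * siteBraiding R ρ (n + 1) =
      siteBraiding R ρ n * siteBraiding R ρ (n + 1) * siteBraiding R ρ n := by
  have hl := adjacentSwap_left
  have hr := adjacentSwap_right
  have h0 : adjacentSwap (n + 1) n = n := adjacentSwap_of_ne (by omega) (by omega)
  have h2 : adjacentSwap n (n + 1 + 1) = n + 1 + 1 := adjacentSwap_of_ne (by omega) (by omega)
  have hyb := hR.yangBaxter (commute_siteRep ρ (show n + 1 + 1 ≠ n + 1 by omega))
    (commute_siteRep ρ (show n + 1 + 1 ≠ n by omega))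
    (commute_siteRep ρ (show n + 1 ≠ n by omega))
  have h1 := congrArg (sitePerm k ι) (isAdjacentSystem_adjacentSwap.braid n)
  simp only [map_mul] at h1
  have e1 := sitePerm_mul_placeAt ρ (adjacentSwap (n + 1)) (hl (n + 1)) h0 R
  have e2 := sitePerm_mul_placeAt ρ (adjacentSwap n) h2 (hr n) R
  have e3 := sitePerm_mul_placeAt ρ (adjacentSwap (n + 1)) (hr (n + 1)) h0 R
  have e4 := sitePerm_mul_placeAt ρ (adjacentSwap n) h2 (hl n) R
  rw [siteBraiding_eq, siteBraiding_eq]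
  generalize sitePerm k ι (adjacentSwap n) = p at *
  generalize sitePerm k ι (adjacentSwap (n + 1)) = q at *
  generalize placeAt (siteRep ρ (n + 1 + 1)) (siteRep ρ (n + 1)) R = x at *
  generalize placeAt (siteRep ρ (n + 1 + 1)) (siteRep ρ n) R = y at *
  generalize placeAt (siteRep ρ (n + 1)) (siteRep ρ n) R = z at *
  -- All site permutations are moved to the right, relabelling the sites of each `R`. This separates
  -- the Yang–Baxter equation for `x, y, z` from the braid relation for `p, q`.
  calc x * q * (z * p) * (x * q) = x * (q * z) * (p * x) * q := by simp only [mul_assoc]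
    _ = x * y * (q * y) * p * q := by rw [e1, e2]; simp only [mul_assoc]
    _ = x * y * z * (q * p * q) := by rw [e3]; simp only [mul_assoc]
    _ = z * y * x * (p * q * p) := by rw [hyb, h1]
    _ = z * y * (p * y) * q * p := by rw [e4]; simp only [mul_assoc]
    _ = z * (p * x) * (q * z) * p := by rw [e1, e2]; simp only [mul_assoc]
    _ = z * p * (x * q) * (z * p) := by simp only [mul_assoc]

theorem commute_siteBraiding_siteHom (R : H ⊗[k] H) (ρ : H →ₐ[k] Matrix ι ι k) {n i : ℕ}
    (h : i ≠ n) (h' : i ≠ n + 1) (X : Matrix ι ι k) :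
    Commute (siteBraiding R ρ n) (siteHom i X) := by
  have h1 := semiconj_sitePerm (adjacentSwap n) i X
  rw [adjacentSwap_of_ne h h'] at h1
  exact Commute.mul_left h1 (commute_placeAt (fun a => commute_siteHom h _ _)
    (fun a => commute_siteHom h' _ _) R).symm

end BraidSystem

/-! ### The Markov property and integrality -/

section Integrality

variable {k H ι : Type*} [Field k] [Ring H] [HopfAlgebra k H] [Fintype ι] [DecidableEq ι]

/-- Closing the second strand of the flip composed with `a ⊗ b` leaves `b u a` on the first, and
these sum to `1`. This is the reason for weighting the trace by `u`. -/
theorem sitePartialTrace_siteBraiding {R : H ⊗[k] H} (hR : IsQuasitriangular R)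
    (ρ : H →ₐ[k] Matrix ι ι k) (n : ℕ) :
    sitePartialTrace (ρ (drinfeldElement R)) (n + 1) (siteBraiding R ρ n) = 1 := by
  have h : ∀ T : H ⊗[k] H,
      sitePartialTrace (ρ (drinfeldElement R)) (n + 1) (siteBraiding T ρ n) =
        siteRep ρ n (sandwich k (drinfeldElement R) T) := by
    intro T
    induction T with
    | zero => simp [siteBraiding]
    | add x y hx hy =>
      rw [map_add, map_add, ← hx, ← hy, ← map_add, siteBraiding, map_add, mul_add]
      rfl
    | tmul a b =>
      rw [siteBraiding, placeAt_tmul, sandwich_tmul, siteRep, siteRep, AlgHom.comp_apply,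
        AlgHom.comp_apply, AlgHom.comp_apply, sitePartialTrace_swap_mul, map_mul ρ, map_mul ρ]
  rw [h, hR.sandwich_drinfeldElement, map_one]

theorem commute_siteBraiding {R : H ⊗[k] H} (ρ : H →ₐ[k] Matrix ι ι k) {m n : ℕ}
    (h : m + 1 < n) : Commute (siteBraiding R ρ n) (siteBraiding R ρ m) := by
  refine Commute.mul_right (Commute.mul_left ?_ ?_) (commute_placeAt
    (fun a => commute_siteBraiding_siteHom R ρ (by omega) (by omega) _)
    (fun a => commute_siteBraiding_siteHom R ρ (by omega) (by omega) _) R)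
  · exact (isAdjacentSystem_adjacentSwap.far m n h).map (sitePerm k ι)
  · exact (sitePerm_mul_placeAt ρ (adjacentSwap m) (adjacentSwap_of_ne (by omega) (by omega))
      (adjacentSwap_of_ne (by omega) (by omega)) R).symm

theorem commute_siteHom_of_mem_strandMonoid (R : H ⊗[k] H) (ρ : H →ₐ[k] Matrix ι ι k) {m n : ℕ}
    (h : n ≤ m) {x : SiteOperator k ι} (hx : x ∈ strandMonoid (siteBraiding R ρ) n)
    (X : Matrix ι ι k) : Commute x (siteHom m X) := by
  have hle : strandMonoid (siteBraiding R ρ) n ≤ Submonoid.centralizer {siteHom m X} :=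
    strandMonoid_le fun i hi => by
      rw [Submonoid.mem_centralizer_iff]
      rintro _ rfl
      exact (commute_siteBraiding_siteHom R ρ (by omega) (by omega) X).symm.eq
  exact (Submonoid.mem_centralizer_iff.1 (hle hx) _ rfl).symm

theorem isMarkovSystem_siteBraiding {R : H ⊗[k] H} (hR : IsTriangular R)
    (ρ : H →ₐ[k] Matrix ι ι k) :
    IsMarkovSystem (siteBraiding R ρ) (sitePartialTrace (ρ (drinfeldElement R)))
      (ρ (drinfeldElement R)).trace where
  mul_self := siteBraiding_mul_self hR ρ
  braid := siteBraiding_braid hR ρ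
  far _ _ h := commute_siteBraiding ρ h
  partialTrace n x hx := by
    -- The operator is read as `x · 1 · 1` with the middle `1` at site `n`, whose weighted trace is
    -- `tr u`.
    have h := sitePartialTrace_mul_mul (ρ (drinfeldElement R))
      (commute_siteHom_of_mem_strandMonoid R ρ le_rfl hx) (fun Y => Commute.one_left _)
      (siteHom n 1)
    rwa [sitePartialTrace_siteHom, map_one, mul_one, mul_one, mul_one, mul_one, mul_smul_comm,
      mul_one] at h
  partialTrace_mul n a ha b hb := by
    rw [sitePartialTrace_mul_mul _ (commute_siteHom_of_mem_strandMonoid R ρ le_rfl ha)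
      (commute_siteHom_of_mem_strandMonoid R ρ le_rfl hb), sitePartialTrace_siteBraiding
      hR.toIsQuasitriangular, mul_one]

theorem siteBraiding_mem (R : H ⊗[k] H) (ρ : H →ₐ[k] Matrix ι ι k) {n : ℕ}
    {D : Subalgebra k (SiteOperator k ι)} (hD : ∀ i < n, ∀ X, siteHom i X ∈ D) {i : ℕ}
    (hi : i + 1 < n) : siteBraiding R ρ i ∈ D := by
  refine mul_mem ?_ ?_
  · rw [sitePerm_adjacentSwap]
    exact sum_mem fun a _ => sum_mem fun b _ =>
      mul_mem (hD _ (by omega) _) (hD _ (by omega) _)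
  · induction R with
    | zero => rw [map_zero]; exact zero_mem _
    | add x y hx hy => rw [map_add]; exact add_mem hx hy
    | tmul a b =>
      rw [placeAt_tmul]
      exact mul_mem (hD _ (by omega) _) (hD _ (by omega) _)

/-- The trace of the Drinfeld element in a matrix representation is an integer. -/
theorem exists_int_eq_trace_drinfeldElement [Nonempty ι] {R : H ⊗[k] H} (hR : IsTriangular R)
    (ρ : H →ₐ[k] Matrix ι ι k) : ∃ m : ℤ, (ρ (drinfeldElement R)).trace = m := by
  refine (isMarkovSystem_siteBraiding hR ρ).exists_int_eq
    (Fintype.card ι * Fintype.card ι) fun n => ?_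
  obtain ⟨D, hfin, hle, hmem, -⟩ := exists_subalgebra_siteHom k ι n
  refine ⟨Subalgebra.toSubmodule D, hfin, hle, fun x hx => ?_⟩
  have h : strandMonoid (siteBraiding R ρ) n ≤ D.toSubmonoid :=
    strandMonoid_le fun i hi => siteBraiding_mem R ρ hmem hi
  exact h hx

end Integrality
end TriangularHopf

theorem corollary7p3 {H : Type*} [Ring H] [HopfAlgebra ℂ H]
    (R : H ⊗[ℂ] H) (hR : TriangularHopf.IsTriangular R)
    {V : Type*} [AddCommGroup V] [Module ℂ V] [FiniteDimensional ℂ V]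
    (ρ : H →ₐ[ℂ] Module.End ℂ V) :
    ∃ n : ℤ, TriangularHopf.categoricalDim R ρ = (n : ℂ) ∧
      LinearMap.trace ℂ V (ρ (TriangularHopf.drinfeldElement R)) = (n : ℂ) := by
  suffices h : ∃ n : ℤ, LinearMap.trace ℂ V (ρ (TriangularHopf.drinfeldElement R)) = (n : ℂ) by
    obtain ⟨n, hn⟩ := h
    exact ⟨n, (TriangularHopf.categoricalDim_eq_trace R ρ).trans hn, hn⟩
  -- The zero representation is set aside because the counting argument needs a nontrivial operator
  -- algebra, hence a nonempty basis.
  rcases subsingleton_or_nontrivial V with hV | hV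
  · exact ⟨0, by rw [Subsingleton.elim (ρ (TriangularHopf.drinfeldElement R)) 0]; simp⟩
  · let b := Module.finBasis ℂ V
    have : Nonempty (Fin (Module.finrank ℂ V)) := b.index_nonempty
    obtain ⟨n, hn⟩ := TriangularHopf.exists_int_eq_trace_drinfeldElement hR
      ((LinearMap.toMatrixAlgEquiv b).toAlgHom.comp ρ)
    exact ⟨n, (LinearMap.trace_eq_matrix_trace ℂ b _).trans hn⟩
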